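/- Let $\sigma_0=\mathbb 1$ and let $\sigma_1,\sigma_2,\sigma_3$ be the Pauli matrices. A Pauli channel is a map $\mathcal E[\rho]=\sum_{i=0}^3 p_i\,\sigma_i\rho\sigma_i$ on $M_2(\mathbb C)$ with $p_i\ge 0$ and $\sum_i p_i=1$; its nontrivial eigenvalues are the real numbers $\lambda_1,\lambda_2,\lambda_3$ with $\mathcal E[\sigma_i]=\lambda_i\sigma_i$. A linear map $L$ on $M_2(\mathbb C)$ has Lindblad form if $$L[\rho]=\mathrm i[\rho,H]+\sum_{i,j}G_{ij}\Big(F_i\rho F_j^\dagger-\tfrac12\{F_j^\dagger F_i,\rho\}\Big)$$ for a Hermitian matrix $H$, a finite family of matrices $F_i\in M_2(\mathbb C)$ and a positive semidefinite matrix $G$. Let $\mathsf C^{L}$ (the L-divisible qubit channels) be the closure of the set of non-singular completely positive trace-preserving maps of the form $\exp(L)$ with $L$ of Lindblad form. **Theorem (L-divisibility of Pauli channels).** Let $\mathcal E$ be a non-singular Pauli channel with nontrivial eigenvalues $\lambda_1,\lambda_2,\lambda_3$. Then $\mathcal E\in\mathsf C^{L}$ if and only if 1. either $\lambda_1,\lambda_2,\lambda_3>0$,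 or, up to a permutation, $(\lambda_1,\lambda_2,\lambda_3)=(\eta,-\lambda,-\lambda)$ with $\eta,\lambda>0$; and 2. $\dfrac{\lambda_i}{\lambda_j\lambda_k}\ge 1$ for all mutually different $i,j,k\in\{1,2,3\}$. Moreover, in both cases of (1) it suffices to test the principal branch of the real logarithm. In the Pauli basis $(\sigma_0,\sigma_1,\sigma_2,\sigma_3)$, let $L_0=\operatorname{diag}(0,\log\lambda_1,\log\lambda_2,\log\lambda_3)$ if all $\lambda_i$ are positive. If instead $\lambda_i=\eta$ and $\lambda_j=\lambda_k=-\lambda$ with $\{i,j,k\}=\{1,2,3\}$ and $\eta,\lambda>0$, let $L_0$ be the matrix with $0$ on $\sigma_0$, $\log\eta$ on $\sigma_i$, and the block $\begin{pmatrix}\log\lambda&\pi\\-\pi&\log\lambda\end{pmatrix}$ on $(\sigma_j,\sigma_k)$, for either order of $j$ and $k$. Then $\exp(L_0)=\mathcal E$, and $\mathcal E\in\mathsf C^{L}$ if and only if $L_0$ has Lindblad form. -/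

import Mathlib

open scoped Matrix ComplexOrder

/-- Linear maps on the complex `n × n` matrices (automatically continuous, by finite
dimensionality), with the topology of uniform convergence on bounded sets (the operator norm topology). -/
noncomputable abbrev Superoperator (n : Type*) [Fintype n] [DecidableEq n] :=
  Matrix n n ℂ →L[ℂ] Matrix n n ℂ

/-- Multiplication is composition, and it is jointly continuous; the exponential needs this. -/
instance superoperatorIsTopologicalRing (n : Type*) [Fintype n] [DecidableEq n] :
    IsTopologicalRing (Superoperator n) :=
  inferInstanceAs (IsTopologicalRing ((n → n → ℂ) →L[ℂ] (n → n → ℂ)))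

/-- The action of `id_k ⊗ E` on `X ∈ M_k ⊗ M_n`: the map `E` acts on each `n × n` block of `X`. -/
noncomputable def ampliation {n : Type*} [Fintype n] [DecidableEq n] (k : ℕ) (E : Superoperator n)
    (X : Matrix (Fin k × n) (Fin k × n) ℂ) : Matrix (Fin k × n) (Fin k × n) ℂ :=
  Matrix.of fun x y => E (Matrix.of fun a b => X (x.1, a) (y.1, b)) x.2 y.2

/-- Completely positive trace-preserving maps. -/
def IsQuantumChannel {n : Type*} [Fintype n] [DecidableEq n] (E : Superoperator n) : Prop :=
  (∀ (k : ℕ) (X : Matrix (Fin k × n) (Fin k × n) ℂ), X.PosSemidef → (ampliation k E X).PosSemidef) ∧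
    ∀ ρ : Matrix n n ℂ, (E ρ).trace = ρ.trace

/-- `L[ρ] = i[ρ, H] + ∑ i j, G i j (F i ρ (F j)† - ½ {(F j)† F i, ρ})` with `H` Hermitian and
`G` positive semidefinite. -/
def HasLindbladForm {n : Type*} [Fintype n] [DecidableEq n] (L : Superoperator n) : Prop :=
  ∃ (H : Matrix n n ℂ) (m : ℕ) (F : Fin m → Matrix n n ℂ) (G : Matrix (Fin m) (Fin m) ℂ),
    H.IsHermitian ∧ G.PosSemidef ∧
      ∀ ρ : Matrix n n ℂ, L ρ = Complex.I • (ρ * H - H * ρ) +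
        ∑ i, ∑ j, G i j • (F i * ρ * (F j)ᴴ -
          (1 / 2 : ℂ) • ((F j)ᴴ * F i * ρ + ρ * ((F j)ᴴ * F i)))

/-- Non-singular channels with at least one logarithm of Lindblad form. -/
def channelsWithLindbladLog (n : Type*) [Fintype n] [DecidableEq n] : Set (Superoperator n) :=
  {E | IsQuantumChannel E ∧ IsUnit E ∧
    ∃ L : Superoperator n, NormedSpace.exp L = E ∧ HasLindbladForm L}

/-- The L-divisible channels. -/
def lDivisibleChannels (n : Type*) [Fintype n] [DecidableEq n] : Set (Superoperator n) :=
  closure (channelsWithLindbladLog n)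

/-- The identity followed by the three Pauli matrices. -/
def pauliMatrix : Fin 4 → Matrix (Fin 2) (Fin 2) ℂ :=
  ![1, !![0, 1; 1, 0], !![0, -Complex.I; Complex.I, 0], !![1, 0; 0, -1]]

/-- Pauli channels: `E[ρ] = ∑ i, p i σ_i ρ σ_i` for a probability vector `p`. -/
def IsPauliChannel (E : Superoperator (Fin 2)) : Prop :=
  ∃ p : Fin 4 → ℝ, (∀ i, 0 ≤ p i) ∧ ∑ i, p i = 1 ∧
    ∀ ρ, E ρ = ∑ i, (p i : ℂ) • (pauliMatrix i * ρ * pauliMatrix i)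

/-- `lam` lists the nontrivial eigenvalues of `E`, those on the three Pauli matrices. -/
def HasPauliEigenvalues (E : Superoperator (Fin 2)) (lam : Fin 3 → ℝ) : Prop :=
  ∀ i : Fin 3, E (pauliMatrix i.succ) = (lam i : ℂ) • pauliMatrix i.succ

/-- The map on `M_2(ℂ)` which kills the identity and has the real matrix `A` on the span of
the three Pauli matrices: `σ_b ↦ ∑ a, A a b σ_a`. Its matrix in the Pauli basis is `0 ⊕ A`. -/
noncomputable def ofBlochMatrix (A : Matrix (Fin 3) (Fin 3) ℝ) : Superoperator (Fin 2) :=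
  LinearMap.toContinuousLinearMap
    { toFun := fun ρ => ∑ a : Fin 3, ∑ b : Fin 3,
        ((A a b : ℂ) * ((pauliMatrix b.succ * ρ).trace / 2)) • pauliMatrix a.succ
      map_add' := fun ρ τ => by
        simp only [Matrix.trace_add, add_div, mul_add, add_smul,
          Finset.sum_add_distrib]
      map_smul' := fun c ρ => by
        simp only [Matrix.mul_smul, Matrix.trace_smul, smul_eq_mul, RingHom.id_apply,
          Finset.smul_sum, smul_smul]
        refine Finset.sum_congr rfl fun a _ => Finset.sum_congr rfl fun b _ => ?_
        congr 1
        ring }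

/-- The principal logarithm `diag(0, log λ₁, log λ₂, log λ₃)` in the Pauli basis, for positive
eigenvalues. -/
noncomputable def principalLogPos (lam : Fin 3 → ℝ) : Superoperator (Fin 2) :=
  ofBlochMatrix (Matrix.diagonal fun i => Real.log (lam i))

/-- The principal branch of the real logarithm in the Pauli basis, for eigenvalues `η > 0` at
`i` and `-l < 0` at both `j` and `k`: `log η` at `i`, and the block
`(log l, π; -π, log l)` on the coordinates `j, k`. -/
noncomputable def principalLogNeg (η l : ℝ) (i j k : Fin 3) : Superoperator (Fin 2) :=
  ofBlochMatrix (Matrix.single i i (Real.log η) + Matrix.single j j (Real.log l) +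
    Matrix.single k k (Real.log l) + Matrix.single j k Real.pi - Matrix.single k j Real.pi)

/-! ### The exponential of a superoperator, evaluated on a matrix -/

/-! Necessity comes from two inequalities that survive closure. A Lindblad generator preserves
Hermiticity and has traceless image, so even when it is not unital it acts on the traceless
Hermitian matrices by a real 3×3 matrix `M`, and `exp L` acts there by `A = exp M`. Positivity of
`G` gives `tr M |x|² ≤ 2 x·Mx` (`HasLindbladForm.trace_mul_dotProduct_le`); integrating along the
flow and using `det A = exp (tr M)` yields `det A |x|² ≤ |Ax|²`. Moreover `A` is the square of a
real matrix, so `det (y² + A) ≥ 0` for all real `y`.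

For diagonal `A` the first inequality at basis vectors is condition 2. The second forces an even
number of negative eigenvalues at `y = 0`, and two distinct negative ones would be separated by a
suitable `y²`. Conversely, condition 2 says exactly that the rates of the explicit logarithm `L₀`
are nonnegative (`hasLindbladForm_ofBlochMatrix`); the block with `π` only adds a Hamiltonian
rotation. -/

theorem hasSum_exp_apply {V : Type*} [NormedAddCommGroup V] [NormedSpace ℂ V] [CompleteSpace V]
    (L : V →L[ℂ] V) (v : V) :
    HasSum (fun k : ℕ => (k.factorial : ℂ)⁻¹ • (L ^ k) v) (NormedSpace.exp L v) := by
  simpa using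
    (ContinuousLinearMap.apply ℂ V v).hasSum (NormedSpace.exp_series_hasSum_exp' (𝕂 := ℂ) L)

theorem Superoperator.hasSum_exp_apply {n : Type*} [Fintype n] [DecidableEq n]
    (L : Superoperator n) (X : Matrix n n ℂ) :
    HasSum (fun k : ℕ => (k.factorial : ℂ)⁻¹ • (L ^ k) X) (NormedSpace.exp L X) :=
  -- Matrices are unfolded to functions, whose sup norm induces the same topology.
  _root_.hasSum_exp_apply (V := n → n → ℂ) L X

theorem Superoperator.exp_apply_eigenvector {n : Type*} [Fintype n] [DecidableEq n]
    {L : Superoperator n} {X : Matrix n n ℂ} {c : ℂ} (h : L X = c • X) :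
    NormedSpace.exp L X = Complex.exp c • X := by
  have hpow : ∀ k : ℕ, (L ^ k) X = c ^ k • X := by
    intro k
    induction k with
    | zero => simp
    | succ k ih => rw [pow_succ, mul_apply_eq_comp, h, map_smul, ih, smul_smul, pow_succ']
  have h1 := L.hasSum_exp_apply X
  have h2 := (NormedSpace.exp_series_hasSum_exp' (𝕂 := ℂ) c).smul_const X
  rw [← Complex.exp_eq_exp_ℂ] at h2
  refine h1.unique (h2.congr_fun fun k => ?_)
  simp [hpow, smul_smul]

/-! ### Exponentials of real matrices -/

theorem Matrix.hasSum_exp_apply {n : Type*} [Fintype n] [DecidableEq n] (M : Matrix n n ℝ)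
    {W : Type*} [AddCommGroup W] [Module ℝ W] [TopologicalSpace W] [IsTopologicalAddGroup W]
    [ContinuousSMul ℝ W] (f : Matrix n n ℝ →ₗ[ℝ] W) :
    HasSum (fun k : ℕ => (k.factorial : ℝ)⁻¹ • f (M ^ k)) (f (NormedSpace.exp M)) := by
  let _ : NormedRing (Matrix n n ℝ) := Matrix.linftyOpNormedRing
  let _ : NormedAlgebra ℝ (Matrix n n ℝ) := Matrix.linftyOpNormedAlgebra
  exact ((LinearMap.toContinuousLinearMap f).hasSum
    (NormedSpace.exp_series_hasSum_exp' (𝕂 := ℝ) M)).congr_fun fun k => (map_smul f _ _).symm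

theorem Matrix.hasDerivAt_exp_smul_apply {n : Type*} [Fintype n] [DecidableEq n]
    (M : Matrix n n ℝ) (f : Matrix n n ℝ →ₗ[ℝ] ℝ) (t : ℝ) :
    HasDerivAt (fun s : ℝ => f (NormedSpace.exp (s • M))) (f (M * NormedSpace.exp (t • M))) t := by
  let _ : NormedRing (Matrix n n ℝ) := Matrix.linftyOpNormedRing
  let _ : NormedAlgebra ℝ (Matrix n n ℝ) := Matrix.linftyOpNormedAlgebra
  exact (LinearMap.toContinuousLinearMap f).hasFDerivAt.comp_hasDerivAt t
    (hasDerivAt_exp_smul_const' (𝕂 := ℝ) M t)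

theorem Matrix.hasDerivAt_exp_smul_entry {n : Type*} [Fintype n] [DecidableEq n]
    (M : Matrix n n ℝ) (i j : n) (t : ℝ) :
    HasDerivAt (fun s : ℝ => NormedSpace.exp (s • M) i j) ((M * NormedSpace.exp (t • M)) i j) t :=
  M.hasDerivAt_exp_smul_apply (Matrix.entryLinearMap ℝ ℝ i j) t

theorem Matrix.hasDerivAt_exp_smul_mulVec {n : Type*} [Fintype n] [DecidableEq n]
    (M : Matrix n n ℝ) (x : n → ℝ) (i : n) (t : ℝ) :
    HasDerivAt (fun s : ℝ => (NormedSpace.exp (s • M) *ᵥ x) i)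
      ((M *ᵥ (NormedSpace.exp (t • M) *ᵥ x)) i) t := by
  have := M.hasDerivAt_exp_smul_apply
    ((LinearMap.proj i).comp ((Matrix.mulVecBilin ℝ ℝ).flip x)) t
  simpa [Matrix.mulVec_mulVec] using this

/-- Jacobi's formula: `X' = M X` gives `(det X)' = tr M · det X`, so `g` below is constant. The
derivative is taken on the six-term expansion. -/
theorem Matrix.det_exp_fin_three (M : Matrix (Fin 3) (Fin 3) ℝ) :
    (NormedSpace.exp M).det = Real.exp M.trace := by
  set g : ℝ → ℝ := fun t => Real.exp (-(M.trace * t)) * (NormedSpace.exp (t • M)).det with hg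
  have hderiv : ∀ t, HasDerivAt g 0 t := by
    intro t
    have h := M.hasDerivAt_exp_smul_entry
    have hd := ((((((((h 0 0 t).mul (h 1 1 t)).mul (h 2 2 t)).sub
      (((h 0 0 t).mul (h 1 2 t)).mul (h 2 1 t))).sub
      (((h 0 1 t).mul (h 1 0 t)).mul (h 2 2 t))).add
      (((h 0 1 t).mul (h 1 2 t)).mul (h 2 0 t))).add
      (((h 0 2 t).mul (h 1 0 t)).mul (h 2 1 t))).sub
      (((h 0 2 t).mul (h 1 1 t)).mul (h 2 0 t)))
    have he : HasDerivAt (fun s : ℝ => Real.exp (-(M.trace * s)))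
        (Real.exp (-(M.trace * t)) * -(M.trace * 1)) t :=
      (((hasDerivAt_id t).const_mul M.trace).neg).exp
    have hm := he.mul hd
    refine (hm.congr_deriv ?_).congr_of_eventuallyEq
      (.of_forall fun s => by simp [hg, Matrix.det_fin_three])
    simp only [Matrix.mul_apply, Fin.sum_univ_three, Matrix.trace_fin_three, Pi.mul_apply,
      Pi.sub_apply, Pi.add_apply]
    ring
  have hconst : g 1 = g 0 :=
    is_const_of_deriv_eq_zero (fun t => (hderiv t).differentiableAt) (fun t => (hderiv t).deriv) 1 0
  simp only [hg, mul_one, one_smul, mul_zero, neg_zero, Real.exp_zero, zero_smul,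
    NormedSpace.exp_zero, Matrix.det_one] at hconst
  rw [Real.exp_neg] at hconst
  field_simp at hconst
  exact hconst

/-- Grönwall: along `w' = M w` one has `(|w|²)' = 2 w·Mw ≥ τ |w|²`, so `exp (-τt) |w|²` is
nondecreasing; compare `t = 0` and `t = 1`. -/
theorem Matrix.exp_mul_dotProduct_le {n : Type*} [Fintype n] [DecidableEq n] (M : Matrix n n ℝ)
    (τ : ℝ) (hM : ∀ x : n → ℝ, τ * (x ⬝ᵥ x) ≤ 2 * (x ⬝ᵥ M *ᵥ x)) (x : n → ℝ) :
    Real.exp τ * (x ⬝ᵥ x) ≤ (NormedSpace.exp M *ᵥ x) ⬝ᵥ (NormedSpace.exp M *ᵥ x) := by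
  set w : ℝ → n → ℝ := fun t => NormedSpace.exp (t • M) *ᵥ x with hw
  set g : ℝ → ℝ := fun t => Real.exp (-(τ * t)) * (w t ⬝ᵥ w t) with hg
  have hderiv : ∀ t, HasDerivAt g
      (Real.exp (-(τ * t)) * (2 * (w t ⬝ᵥ M *ᵥ w t) - τ * (w t ⬝ᵥ w t))) t := by
    intro t
    have hd : HasDerivAt (fun s => w s ⬝ᵥ w s)
        (∑ i, ((M *ᵥ w t) i * w t i + w t i * (M *ᵥ w t) i)) t :=
      HasDerivAt.fun_sum fun i _ =>
        (M.hasDerivAt_exp_smul_mulVec x i t).mul (M.hasDerivAt_exp_smul_mulVec x i t)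
    have he : HasDerivAt (fun s : ℝ => Real.exp (-(τ * s)))
        (Real.exp (-(τ * t)) * -(τ * 1)) t :=
      (((hasDerivAt_id t).const_mul τ).neg).exp
    refine (he.mul hd).congr_deriv ?_
    have : ∑ i, ((M *ᵥ w t) i * w t i + w t i * (M *ᵥ w t) i) = 2 * (w t ⬝ᵥ M *ᵥ w t) := by
      rw [dotProduct, Finset.mul_sum]
      exact Finset.sum_congr rfl fun i _ => by ring
    rw [this]
    ring
  have hmono : Monotone g := monotone_of_deriv_nonneg (fun t => (hderiv t).differentiableAt)
    fun t => by
      rw [(hderiv t).deriv]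
      exact mul_nonneg (Real.exp_pos _).le (sub_nonneg.2 (hM _))
  have h01 := hmono zero_le_one
  simp only [hg, hw, mul_one, one_smul, mul_zero, neg_zero, Real.exp_zero, zero_smul,
    NormedSpace.exp_zero, Matrix.one_mulVec, one_mul] at h01
  rw [Real.exp_neg, inv_mul_eq_div, le_div_iff₀ (Real.exp_pos τ)] at h01
  linarith

theorem Matrix.det_smul_one_add_mul_self_nonneg (B : Matrix (Fin 3) (Fin 3) ℝ) (y : ℝ) :
    0 ≤ (y ^ 2 • (1 : Matrix (Fin 3) (Fin 3) ℝ) + B * B).det := by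
  -- This is `det (B + iy) det (B - iy) = |det (B + iy)|²`, written as real part squared plus
  -- imaginary part squared.
  have : (y ^ 2 • (1 : Matrix (Fin 3) (Fin 3) ℝ) + B * B).det =
      (B.det - y ^ 2 * B.trace) ^ 2 + y ^ 2 * (B 0 0 * B 1 1 - B 0 1 * B 1 0 + B 0 0 * B 2 2
        - B 0 2 * B 2 0 + B 1 1 * B 2 2 - B 1 2 * B 2 1 - y ^ 2) ^ 2 := by
    simp [Matrix.det_fin_three, Matrix.trace_fin_three, Matrix.mul_apply, Fin.sum_univ_three]
    ring
  rw [this]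
  positivity

theorem Matrix.det_smul_one_add_exp_nonneg (M : Matrix (Fin 3) (Fin 3) ℝ) (y : ℝ) :
    0 ≤ (y ^ 2 • (1 : Matrix (Fin 3) (Fin 3) ℝ) + NormedSpace.exp M).det := by
  have h : NormedSpace.exp M =
      NormedSpace.exp ((1 / 2 : ℝ) • M) * NormedSpace.exp ((1 / 2 : ℝ) • M) := by
    rw [← Matrix.exp_add_of_commute _ _ (Commute.refl _), ← add_smul]
    norm_num
  rw [h]
  exact Matrix.det_smul_one_add_mul_self_nonneg _ y

/-! ### Bloch vectors and Bloch matrices -/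

/-- The traceless Hermitian matrix with Bloch vector `x`. -/
noncomputable def ofBlochVector (x : Fin 3 → ℝ) : Matrix (Fin 2) (Fin 2) ℂ :=
  ∑ a, (x a : ℂ) • pauliMatrix a.succ

theorem ofBlochVector_eq (x : Fin 3 → ℝ) :
    ofBlochVector x = !![(x 2 : ℂ), x 0 - Complex.I * x 1; x 0 + Complex.I * x 1, -x 2] := by
  ext i j
  fin_cases i <;> fin_cases j <;>
    simp [ofBlochVector, Fin.sum_univ_three, pauliMatrix] <;> ring

theorem isHermitian_ofBlochVector (x : Fin 3 → ℝ) : (ofBlochVector x).IsHermitian := by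
  rw [ofBlochVector_eq]
  ext i j
  fin_cases i <;> fin_cases j <;> simp [sub_eq_add_neg]

theorem ofBlochVector_single (b : Fin 3) : ofBlochVector (Pi.single b 1) = pauliMatrix b.succ := by
  simp [ofBlochVector, Pi.single_apply]

/-- The real matrix of a superoperator on the span of the Pauli matrices. -/
noncomputable def blochMatrix (E : Superoperator (Fin 2)) : Matrix (Fin 3) (Fin 3) ℝ :=
  Matrix.of fun a b => ((pauliMatrix a.succ * E (pauliMatrix b.succ)).trace / 2).re

theorem re_trace_pauliMatrix_mul_ofBlochVector (a : Fin 3) (x : Fin 3 → ℝ) :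
    ((pauliMatrix a.succ * ofBlochVector x).trace / 2).re = x a := by
  rw [ofBlochVector_eq]
  fin_cases a <;> simp [pauliMatrix, Matrix.trace_fin_two]

theorem Matrix.IsHermitian.eq_ofBlochVector {X : Matrix (Fin 2) (Fin 2) ℂ} (hX : X.IsHermitian)
    (htr : X.trace = 0) :
    X = ofBlochVector fun a => ((pauliMatrix a.succ * X).trace / 2).re := by
  have h00 := Complex.ext_iff.1 (hX.apply 0 0)
  have h01 := Complex.ext_iff.1 (hX.apply 0 1)
  have ht := Complex.ext_iff.1 htr
  simp [Matrix.trace_fin_two] at h00 h01 ht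
  rw [ofBlochVector_eq]
  ext i j
  fin_cases i <;> fin_cases j <;> apply Complex.ext <;>
    simp [pauliMatrix, Matrix.trace_fin_two, Matrix.vecMul, dotProduct] <;> linarith [h00, h01.1, h01.2, ht.1, ht.2]

theorem apply_ofBlochVector (E : Superoperator (Fin 2)) (x : Fin 3 → ℝ) :
    E (ofBlochVector x) = ∑ b, (x b : ℂ) • E (pauliMatrix b.succ) := by
  simp [ofBlochVector]

theorem re_trace_pauliMatrix_mul_apply (E : Superoperator (Fin 2)) (x : Fin 3 → ℝ) (a : Fin 3) :
    ((pauliMatrix a.succ * E (ofBlochVector x)).trace / 2).re = (blochMatrix E *ᵥ x) a := by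
  rw [apply_ofBlochVector]
  simp [Matrix.mulVec, dotProduct, blochMatrix, Fin.sum_univ_three, mul_add, Matrix.trace_add]
  ring

theorem blochMatrix_eq_of_intertwines {E : Superoperator (Fin 2)} {A : Matrix (Fin 3) (Fin 3) ℝ}
    (h : ∀ x, E (ofBlochVector x) = ofBlochVector (A *ᵥ x)) : blochMatrix E = A := by
  ext a b
  rw [blochMatrix, Matrix.of_apply, ← ofBlochVector_single b, h,
    re_trace_pauliMatrix_mul_ofBlochVector]
  simp

/-- The intertwining passes to powers, then termwise to the exponential series. -/
theorem exp_apply_ofBlochVector {L : Superoperator (Fin 2)} {M : Matrix (Fin 3) (Fin 3) ℝ}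
    (h : ∀ x, L (ofBlochVector x) = ofBlochVector (M *ᵥ x)) (x : Fin 3 → ℝ) :
    NormedSpace.exp L (ofBlochVector x) = ofBlochVector (NormedSpace.exp M *ᵥ x) := by
  have hpow : ∀ k : ℕ, (L ^ k) (ofBlochVector x) = ofBlochVector ((M ^ k) *ᵥ x) := by
    intro k
    induction k with
    | zero => simp
    | succ k ih =>
      rw [pow_succ', mul_apply_eq_comp, ih, h, Matrix.mulVec_mulVec, pow_succ']
  let f : Matrix (Fin 3) (Fin 3) ℝ →ₗ[ℝ] Matrix (Fin 2) (Fin 2) ℂ :=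
    { toFun := fun A => ofBlochVector (A *ᵥ x)
      map_add' := fun A B => by
        simp [ofBlochVector, Matrix.add_mulVec, add_smul, Finset.sum_add_distrib]
      map_smul' := fun c A => by
        simp [ofBlochVector, Matrix.smul_mulVec, Finset.smul_sum, mul_smul] }
  refine (L.hasSum_exp_apply (ofBlochVector x)).unique ((M.hasSum_exp_apply f).congr_fun fun k => ?_)
  rw [hpow, ← Complex.coe_smul]
  simp [f]

theorem blochMatrix_exp {L : Superoperator (Fin 2)}
    (h : ∀ x, L (ofBlochVector x) = ofBlochVector (blochMatrix L *ᵥ x)) :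
    blochMatrix (NormedSpace.exp L) = NormedSpace.exp (blochMatrix L) :=
  blochMatrix_eq_of_intertwines (exp_apply_ofBlochVector h)

theorem continuous_superoperator_apply {n : Type*} [Fintype n] [DecidableEq n]
    (X : Matrix n n ℂ) : Continuous fun E : Superoperator n => E X :=
  (ContinuousLinearMap.apply ℂ (E := n → n → ℂ) (n → n → ℂ) X).continuous

theorem continuous_blochMatrix : Continuous blochMatrix :=
  continuous_matrix fun _ b => Complex.continuous_re.comp
    (((continuous_const.matrix_mul
      (continuous_superoperator_apply (pauliMatrix b.succ))).matrix_trace).div_const 2)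

/-! ### Generators of Lindblad form -/

theorem HasLindbladForm.conjTranspose_apply {n : Type*} [Fintype n] [DecidableEq n]
    {L : Superoperator n} (hL : HasLindbladForm L) (ρ : Matrix n n ℂ) : (L ρ)ᴴ = L ρᴴ := by
  obtain ⟨H, m, F, G, hH, hG, h⟩ := hL
  rw [h, h, Matrix.conjTranspose_add]
  congr 1
  · simp only [Matrix.conjTranspose_smul, Matrix.conjTranspose_sub, Matrix.conjTranspose_mul, hH.eq]
    simp [smul_sub, neg_add_eq_sub]
  · rw [Matrix.conjTranspose_sum, Finset.sum_comm]
    simp only [Matrix.conjTranspose_sum]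
    rw [Finset.sum_comm, Finset.sum_comm]
    refine Finset.sum_congr rfl fun i _ => Finset.sum_congr rfl fun j _ => ?_
    -- Adjoints exchange the roles of `F i` and `F j`, so the terms are paired with transposed
    -- indices; Hermiticity of `G` matches the coefficients.
    rw [Matrix.conjTranspose_smul, hG.isHermitian.apply]
    simp [Matrix.mul_assoc, add_comm]

theorem HasLindbladForm.trace_apply {n : Type*} [Fintype n] [DecidableEq n]
    {L : Superoperator n} (hL : HasLindbladForm L) (ρ : Matrix n n ℂ) : (L ρ).trace = 0 := by
  obtain ⟨H, m, F, G, hH, hG, h⟩ := hL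
  rw [h]
  simp only [Matrix.trace_add, Matrix.trace_smul, Matrix.trace_sub, Matrix.trace_sum]
  rw [Matrix.trace_mul_comm ρ H, sub_self, smul_zero, zero_add]
  refine Finset.sum_eq_zero fun i _ => Finset.sum_eq_zero fun j _ => ?_
  rw [Matrix.trace_mul_comm ρ, Matrix.trace_mul_comm (F i * ρ), ← Matrix.mul_assoc, ← two_smul ℂ,
    smul_smul]
  simp

theorem HasLindbladForm.apply_ofBlochVector {L : Superoperator (Fin 2)} (hL : HasLindbladForm L)
    (x : Fin 3 → ℝ) : L (ofBlochVector x) = ofBlochVector (blochMatrix L *ᵥ x) := by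
  have hH : (L (ofBlochVector x)).IsHermitian := by
    rw [Matrix.IsHermitian, hL.conjTranspose_apply, (isHermitian_ofBlochVector x).eq]
  rw [hH.eq_ofBlochVector (hL.trace_apply _)]
  simp only [re_trace_pauliMatrix_mul_apply]

/-- The functional `tr(S L[S]) - ½ |x|² ∑ b, tr(σ_b L[σ_b])`, where `S` has Bloch vector `x`. -/
noncomputable def dissipationForm (x : Fin 3 → ℝ) :
    (Matrix (Fin 2) (Fin 2) ℂ → Matrix (Fin 2) (Fin 2) ℂ) →ₗ[ℂ] ℂ where
  toFun L := (ofBlochVector x * L (ofBlochVector x)).trace -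
    (1 / 2 : ℂ) * (x ⬝ᵥ x : ℝ) * ∑ b : Fin 3, (pauliMatrix b.succ * L (pauliMatrix b.succ)).trace
  map_add' L K := by
    simp only [Pi.add_apply, Matrix.mul_add, Matrix.trace_add, Finset.sum_add_distrib]
    ring
  map_smul' c L := by
    simp only [Pi.smul_apply, Matrix.mul_smul, Matrix.trace_smul, ← Finset.mul_sum, smul_eq_mul,
      RingHom.id_apply]
    ring

theorem dissipationForm_apply (x : Fin 3 → ℝ)
    (L : Matrix (Fin 2) (Fin 2) ℂ → Matrix (Fin 2) (Fin 2) ℂ) :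
    dissipationForm x L = (ofBlochVector x * L (ofBlochVector x)).trace -
      (1 / 2 : ℂ) * (x ⬝ᵥ x : ℝ) *
        ∑ b : Fin 3, (pauliMatrix b.succ * L (pauliMatrix b.succ)).trace :=
  rfl

theorem dissipationForm_commutator (x : Fin 3 → ℝ) (H : Matrix (Fin 2) (Fin 2) ℂ) :
    dissipationForm x (fun ρ => ρ * H - H * ρ) = 0 := by
  have h : ∀ S : Matrix (Fin 2) (Fin 2) ℂ, (S * (S * H - H * S)).trace = 0 := fun S => by
    rw [Matrix.mul_sub, Matrix.trace_sub, ← Matrix.mul_assoc S H S, Matrix.trace_mul_comm (S * H),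
      sub_self]
  simp [dissipationForm_apply, h]

/-- The subtracted trace term in `dissipationForm` is chosen so that each dissipator contributes a
product of two linear functionals. With `K = Fᴴ` these are conjugate, which exposes the sign coming
from `G`. -/
theorem dissipationForm_dissipator (x : Fin 3 → ℝ) (F K : Matrix (Fin 2) (Fin 2) ℂ) :
    dissipationForm x
      (fun ρ => F * ρ * K - (1 / 2 : ℂ) • (K * F * ρ + ρ * (K * F))) =
      (ofBlochVector x * F).trace * (ofBlochVector x * K).trace := by
  rw [dissipationForm_apply, ofBlochVector_eq, F.eta_fin_two, K.eta_fin_two]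
  simp [Fin.sum_univ_three, pauliMatrix, Matrix.trace_fin_two, Matrix.mul_apply, dotProduct,
    Fin.sum_univ_two]
  ring_nf
  simp only [Complex.I_sq]
  ring

theorem HasLindbladForm.trace_mul_dotProduct_le {L : Superoperator (Fin 2)}
    (hL : HasLindbladForm L) (x : Fin 3 → ℝ) :
    (blochMatrix L).trace * (x ⬝ᵥ x) ≤ 2 * (x ⬝ᵥ blochMatrix L *ᵥ x) := by
  have hre : (dissipationForm x L).re =
      2 * (x ⬝ᵥ blochMatrix L *ᵥ x) - (blochMatrix L).trace * (x ⬝ᵥ x) := by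
    have h1 : (ofBlochVector x * L (ofBlochVector x)).trace.re =
        2 * (x ⬝ᵥ blochMatrix L *ᵥ x) := by
      simp only [dotProduct, ← re_trace_pauliMatrix_mul_apply]
      rw [ofBlochVector, Finset.sum_mul]
      simp [Fin.sum_univ_three, Matrix.trace_add]
      ring
    rw [dissipationForm_apply, Complex.sub_re, h1]
    simp [blochMatrix, Matrix.trace_fin_three, Fin.sum_univ_three]
    ring
  obtain ⟨H, m, F, G, hH, hG, h⟩ := hL
  have hform : dissipationForm x L = ∑ i, ∑ j, G i j *
      ((ofBlochVector x * F i).trace * (ofBlochVector x * (F j)ᴴ).trace) := by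
    have hsplit : (L : Matrix (Fin 2) (Fin 2) ℂ → Matrix (Fin 2) (Fin 2) ℂ) =
        Complex.I • (fun ρ => ρ * H - H * ρ) + ∑ i, ∑ j, G i j • (fun ρ => F i * ρ * (F j)ᴴ -
          (1 / 2 : ℂ) • ((F j)ᴴ * F i * ρ + ρ * ((F j)ᴴ * F i))) := by
      funext ρ
      simp [h]
    rw [hsplit]
    simp only [map_add, map_sum, map_smul, dissipationForm_commutator, dissipationForm_dissipator,
      smul_eq_mul, mul_zero, zero_add]
  have hstar : ∀ j, (ofBlochVector x * (F j)ᴴ).trace = star (ofBlochVector x * F j).trace := by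
    intro j
    rw [← Matrix.trace_conjTranspose, Matrix.conjTranspose_mul, (isHermitian_ofBlochVector x).eq,
      Matrix.trace_mul_comm]
  -- The vector is conjugated because the form pairs `G i j` with the trace of `F i` and the
  -- conjugate trace of `F j`.
  have hpos := hG.dotProduct_mulVec_nonneg fun j => star (ofBlochVector x * F j).trace
  have hsum : dissipationForm x L = (star fun j => star (ofBlochVector x * F j).trace) ⬝ᵥ
      G *ᵥ fun j => star (ofBlochVector x * F j).trace := by
    simp only [hform, dotProduct, Matrix.mulVec, Finset.mul_sum, hstar, Pi.star_apply, star_star]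
    exact Finset.sum_congr rfl fun i _ => Finset.sum_congr rfl fun j _ => by ring
  rw [← hsum] at hpos
  have := (Complex.le_def.1 hpos).1
  rw [hre, Complex.zero_re] at this
  linarith

/-! ### Lindblad generators from rates and a rotation vector. -/

theorem pauliMatrix_mul_self (i : Fin 4) : pauliMatrix i * pauliMatrix i = 1 := by
  ext a b
  fin_cases i <;> fin_cases a <;> fin_cases b <;> simp [pauliMatrix]

theorem pauliMatrix_conjTranspose (i : Fin 4) : (pauliMatrix i)ᴴ = pauliMatrix i := by
  ext a b
  fin_cases i <;> fin_cases a <;> fin_cases b <;> simp [pauliMatrix]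

/-- The antisymmetric part is `x ↦ h × x`, generated by the Hamiltonian with Bloch vector `h / 2`.
Dissipation along `σ_a` at rate `g_a` kills `σ_a` and scales the other two Pauli matrices by `-2
g_a`; solving for the rates gives `4 g_0 = d 0 - d 1 - d 2` and its permutations. -/
theorem hasLindbladForm_ofBlochMatrix (d h : Fin 3 → ℝ) (h0 : d 1 + d 2 ≤ d 0)
    (h1 : d 0 + d 2 ≤ d 1) (h2 : d 0 + d 1 ≤ d 2) :
    HasLindbladForm
      (ofBlochMatrix !![d 0, -h 2, h 1; h 2, d 1, -h 0; -h 1, h 0, d 2]) := by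
  refine ⟨ofBlochVector (fun a => h a / 2), 3, fun a => pauliMatrix a.succ,
    Matrix.diagonal fun a => (((![d 0 - d 1 - d 2, d 1 - d 0 - d 2, d 2 - d 0 - d 1] a) / 4 : ℝ) : ℂ),
    isHermitian_ofBlochVector _, ?_, fun ρ => ?_⟩
  · refine Matrix.PosSemidef.diagonal fun a => ?_
    simp only [Pi.zero_apply, Complex.zero_le_real]
    fin_cases a <;> simp <;> linarith
  · simp only [pauliMatrix_conjTranspose]
    rw [ρ.eta_fin_two, ofBlochVector_eq]
    ext i j
    fin_cases i <;> fin_cases j <;>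
      simp [ofBlochMatrix, Fin.sum_univ_three, Matrix.diagonal_apply, pauliMatrix,
        Matrix.trace_fin_two] <;> ring_nf <;> simp only [Complex.I_sq] <;> ring

/-! ### Superoperators determined on the Pauli matrices -/

theorem ofBlochMatrix_one (A : Matrix (Fin 3) (Fin 3) ℝ) : ofBlochMatrix A 1 = 0 := by
  ext i j
  fin_cases i <;> fin_cases j <;>
    simp [ofBlochMatrix, Fin.sum_univ_three, pauliMatrix, Matrix.trace_fin_two]

theorem ofBlochMatrix_pauliMatrix (A : Matrix (Fin 3) (Fin 3) ℝ) (b : Fin 3) :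
    ofBlochMatrix A (pauliMatrix b.succ) = ∑ a, (A a b : ℂ) • pauliMatrix a.succ := by
  fin_cases b <;>
    simp [ofBlochMatrix, Fin.sum_univ_three, pauliMatrix, Matrix.trace_fin_two]

theorem eq_sum_smul_pauliMatrix (ρ : Matrix (Fin 2) (Fin 2) ℂ) :
    ρ = (ρ.trace / 2) • 1 +
      ∑ a : Fin 3, ((pauliMatrix a.succ * ρ).trace / 2) • pauliMatrix a.succ := by
  rw [ρ.eta_fin_two]
  ext i j
  fin_cases i <;> fin_cases j <;>
    simp [Fin.sum_univ_three, pauliMatrix, Matrix.trace_fin_two] <;> ring_nf <;>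
    simp only [Complex.I_sq] <;> ring

theorem superoperator_ext_pauliMatrix {E K : Superoperator (Fin 2)} (h1 : E 1 = K 1)
    (h : ∀ a : Fin 3, E (pauliMatrix a.succ) = K (pauliMatrix a.succ)) : E = K := by
  refine ContinuousLinearMap.ext fun ρ => ?_
  rw [eq_sum_smul_pauliMatrix ρ]
  simp [h1, h]

theorem exp_ofBlochMatrix_one (A : Matrix (Fin 3) (Fin 3) ℝ) :
    NormedSpace.exp (ofBlochMatrix A) 1 = 1 := by
  rw [Superoperator.exp_apply_eigenvector (c := 0) (by simp [ofBlochMatrix_one])]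
  simp

/-! ### Pauli channels -/

theorem pauliMatrix_ne_zero (i : Fin 4) : pauliMatrix i ≠ 0 := fun h => by
  simpa [h] using pauliMatrix_mul_self i

theorem IsPauliChannel.apply_one {E : Superoperator (Fin 2)} (hE : IsPauliChannel E) :
    E 1 = 1 := by
  obtain ⟨p, -, hp, h⟩ := hE
  rw [h]
  simp only [mul_one, pauliMatrix_mul_self]
  rw [← Finset.sum_smul, ← Complex.ofReal_sum, hp, Complex.ofReal_one, one_smul]

theorem IsPauliChannel.isQuantumChannel {E : Superoperator (Fin 2)} (hE : IsPauliChannel E) :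
    IsQuantumChannel E := by
  obtain ⟨p, hp0, hp, h⟩ := hE
  refine ⟨fun k X hX => ?_, fun ρ => ?_⟩
  -- The Kraus form with operators `1 ⊗ σ_i`.
  · have hk : ampliation k E X = ∑ i, (p i : ℂ) •
        (Matrix.kronecker (1 : Matrix (Fin k) (Fin k) ℂ) (pauliMatrix i) * X *
          (Matrix.kronecker (1 : Matrix (Fin k) (Fin k) ℂ) (pauliMatrix i))ᴴ) := by
      ext x y
      simp only [ampliation, Matrix.of_apply, h, Matrix.sum_apply, Matrix.smul_apply]
      refine Finset.sum_congr rfl fun i _ => ?_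
      congr 1
      simp [Matrix.mul_apply, Matrix.conjTranspose_kronecker, pauliMatrix_conjTranspose,
        Fintype.sum_prod_type, Matrix.one_apply]
    rw [hk]
    exact Matrix.posSemidef_sum _ fun i _ =>
      (hX.mul_mul_conjTranspose_same _).smul (Complex.zero_le_real.2 (hp0 i))
  · rw [h, Matrix.trace_sum]
    simp only [Matrix.trace_smul, Matrix.trace_mul_comm _ (pauliMatrix _)]
    simp only [← Matrix.mul_assoc, pauliMatrix_mul_self, one_mul, smul_eq_mul]
    rw [← Finset.sum_mul, ← Complex.ofReal_sum, hp, Complex.ofReal_one, one_mul]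

theorem HasPauliEigenvalues.blochMatrix_eq {E : Superoperator (Fin 2)} {lam : Fin 3 → ℝ}
    (h : HasPauliEigenvalues E lam) : blochMatrix E = Matrix.diagonal lam := by
  refine blochMatrix_eq_of_intertwines fun x => ?_
  rw [apply_ofBlochVector, ofBlochVector]
  refine Finset.sum_congr rfl fun b _ => ?_
  rw [h, smul_smul, Matrix.mulVec_diagonal]
  congr 1
  push_cast
  ring

theorem HasPauliEigenvalues.ne_zero {E : Superoperator (Fin 2)} {lam : Fin 3 → ℝ}
    (h : HasPauliEigenvalues E lam) (hE : IsUnit E) (i : Fin 3) : lam i ≠ 0 := by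
  intro h0
  obtain ⟨u, rfl⟩ := hE
  have h1 := h i
  rw [h0, Complex.ofReal_zero, zero_smul] at h1
  have h2 := congrArg (fun K : Superoperator (Fin 2) => K (pauliMatrix i.succ)) u.inv_mul
  simp only [mul_apply_eq_comp, h1, map_zero, one_apply_eq_self] at h2
  exact pauliMatrix_ne_zero _ h2.symm

/-! ### Necessary conditions for L-divisibility -/

/-- Non-strict inequalities between continuous functions of `E` pass to limits, so no convergence of
logarithms is needed. -/
theorem blochMatrix_of_mem_lDivisibleChannels {E : Superoperator (Fin 2)}
    (hE : E ∈ lDivisibleChannels (Fin 2)) :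
    (∀ x, (blochMatrix E).det * (x ⬝ᵥ x) ≤ (blochMatrix E *ᵥ x) ⬝ᵥ (blochMatrix E *ᵥ x)) ∧
      ∀ y : ℝ, 0 ≤ (y ^ 2 • (1 : Matrix (Fin 3) (Fin 3) ℝ) + blochMatrix E).det := by
  have hc := continuous_blochMatrix
  have hcl₁ : IsClosed {E : Superoperator (Fin 2) | ∀ x,
      (blochMatrix E).det * (x ⬝ᵥ x) ≤ (blochMatrix E *ᵥ x) ⬝ᵥ (blochMatrix E *ᵥ x)} := by
    simp only [Set.ofPred_forall]
    refine isClosed_iInter fun x => isClosed_le (hc.matrix_det.mul continuous_const) ?_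
    have := hc.matrix_mulVec (continuous_const (y := x))
    exact this.dotProduct this
  have hcl₂ : IsClosed {E : Superoperator (Fin 2) |
      ∀ y : ℝ, 0 ≤ (y ^ 2 • (1 : Matrix (Fin 3) (Fin 3) ℝ) + blochMatrix E).det} := by
    simp only [Set.ofPred_forall]
    exact isClosed_iInter fun y =>
      isClosed_le continuous_const (continuous_const.add hc).matrix_det
  refine closure_minimal ?_ (hcl₁.inter hcl₂) hE
  rintro _ ⟨-, -, L, rfl, hL⟩
  rw [Set.mem_inter_iff, Set.mem_ofPred_eq, Set.mem_ofPred_eq,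
    blochMatrix_exp hL.apply_ofBlochVector]
  refine ⟨fun x => ?_, Matrix.det_smul_one_add_exp_nonneg _⟩
  rw [Matrix.det_exp_fin_three]
  exact Matrix.exp_mul_dotProduct_le _ _ hL.trace_mul_dotProduct_le x

/-! ### The closed conditions for diagonal Bloch matrices. -/

theorem distinct_cases {i j k : Fin 3} (hij : i ≠ j) (hjk : j ≠ k) (hik : i ≠ k) :
    (i = 0 ∧ j = 1 ∧ k = 2) ∨ (i = 0 ∧ j = 2 ∧ k = 1) ∨ (i = 1 ∧ j = 0 ∧ k = 2) ∨
      (i = 1 ∧ j = 2 ∧ k = 0) ∨ (i = 2 ∧ j = 0 ∧ k = 1) ∨ (i = 2 ∧ j = 1 ∧ k = 0) := by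
  omega

theorem mul_mul_eq_of_distinct (lam : Fin 3 → ℝ) {i j k : Fin 3} (hij : i ≠ j) (hjk : j ≠ k)
    (hik : i ≠ k) (f : ℝ → ℝ) : f (lam i) * f (lam j) * f (lam k) =
      f (lam 0) * f (lam 1) * f (lam 2) := by
  obtain ⟨rfl, rfl, rfl⟩ | ⟨rfl, rfl, rfl⟩ | ⟨rfl, rfl, rfl⟩ | ⟨rfl, rfl, rfl⟩ | ⟨rfl, rfl, rfl⟩ |
    ⟨rfl, rfl, rfl⟩ := distinct_cases hij hjk hik
  all_goals ring

theorem exists_distinct (j : Fin 3) : ∃ i k : Fin 3, i ≠ j ∧ j ≠ k ∧ i ≠ k := by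
  revert j
  decide

theorem HasPauliEigenvalues.mul_mul_le_sq {E : Superoperator (Fin 2)} {lam : Fin 3 → ℝ}
    (h : HasPauliEigenvalues E lam) (hE : E ∈ lDivisibleChannels (Fin 2)) {i j k : Fin 3}
    (hij : i ≠ j) (hjk : j ≠ k) (hik : i ≠ k) : lam i * lam j * lam k ≤ lam i ^ 2 := by
  have := (blochMatrix_of_mem_lDivisibleChannels hE).1 (Pi.single i 1)
  rw [h.blochMatrix_eq, Matrix.det_diagonal, Fin.prod_univ_three] at this
  have hprod := mul_mul_eq_of_distinct lam hij hjk hik id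
  simp only [id] at hprod
  rw [hprod, sq]
  simpa [Matrix.mulVec_diagonal] using this

theorem HasPauliEigenvalues.sq_add_mul_nonneg {E : Superoperator (Fin 2)} {lam : Fin 3 → ℝ}
    (h : HasPauliEigenvalues E lam) (hE : E ∈ lDivisibleChannels (Fin 2)) {i j k : Fin 3}
    (hij : i ≠ j) (hjk : j ≠ k) (hik : i ≠ k) (y : ℝ) :
    0 ≤ (y ^ 2 + lam i) * (y ^ 2 + lam j) * (y ^ 2 + lam k) := by
  have := (blochMatrix_of_mem_lDivisibleChannels hE).2 y
  rw [mul_mul_eq_of_distinct lam hij hjk hik fun t => y ^ 2 + t]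
  simpa [h.blochMatrix_eq, Matrix.det_fin_three] using this

theorem HasPauliEigenvalues.mul_mul_pos {E : Superoperator (Fin 2)} {lam : Fin 3 → ℝ}
    (h : HasPauliEigenvalues E lam) (hE : E ∈ lDivisibleChannels (Fin 2)) (hns : IsUnit E)
    {i j k : Fin 3} (hij : i ≠ j) (hjk : j ≠ k) (hik : i ≠ k) :
    0 < lam i * lam j * lam k := by
  have := h.sq_add_mul_nonneg hE hij hjk hik 0
  simp only [ne_eq, OfNat.ofNat_ne_zero, not_false_eq_true, zero_pow, zero_add] at this
  exact this.lt_of_ne' (mul_ne_zero (mul_ne_zero (h.ne_zero hns i) (h.ne_zero hns j))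
    (h.ne_zero hns k))

theorem HasPauliEigenvalues.one_le_div {E : Superoperator (Fin 2)} {lam : Fin 3 → ℝ}
    (h : HasPauliEigenvalues E lam) (hE : E ∈ lDivisibleChannels (Fin 2)) (hns : IsUnit E)
    {i j k : Fin 3} (hij : i ≠ j) (hjk : j ≠ k) (hik : i ≠ k) :
    1 ≤ lam i / (lam j * lam k) := by
  have hpos := h.mul_mul_pos hE hns hij hjk hik
  have hle := h.mul_mul_le_sq hE hij hjk hik
  -- Multiplying both parts by `lam i` makes the denominator the positive determinant.
  rw [← mul_div_mul_left _ _ (h.ne_zero hns i), ← mul_assoc, _root_.one_le_div hpos]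
  linarith

theorem HasPauliEigenvalues.le_of_neg {E : Superoperator (Fin 2)} {lam : Fin 3 → ℝ}
    (h : HasPauliEigenvalues E lam) (hE : E ∈ lDivisibleChannels (Fin 2)) {i j k : Fin 3}
    (hij : i ≠ j) (hjk : j ≠ k) (hik : i ≠ k) (hi : 0 < lam i) (hk : lam k < 0) :
    lam k ≤ lam j := by
  by_contra! hlt
  -- Here `y²` is the midpoint of `-lam k` and `-lam j`, so exactly one of the three factors is
  -- negative.
  have hy := h.sq_add_mul_nonneg hE hij hjk hik (Real.sqrt (-(lam j + lam k) / 2))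
  rw [Real.sq_sqrt (by linarith)] at hy
  exact absurd hy (not_le.2 (mul_neg_of_neg_of_pos
    (mul_neg_of_pos_of_neg (by linarith) (by linarith)) (by linarith)))

theorem HasPauliEigenvalues.sign_pattern {E : Superoperator (Fin 2)} {lam : Fin 3 → ℝ}
    (h : HasPauliEigenvalues E lam) (hE : E ∈ lDivisibleChannels (Fin 2)) (hns : IsUnit E) :
    (∀ i, 0 < lam i) ∨
      ∃ i j k : Fin 3, i ≠ j ∧ j ≠ k ∧ i ≠ k ∧
        ∃ η l : ℝ, 0 < η ∧ 0 < l ∧ lam i = η ∧ lam j = -l ∧ lam k = -l := by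
  by_cases hall : ∀ i, 0 < lam i
  · exact Or.inl hall
  refine Or.inr ?_
  push Not at hall
  obtain ⟨j, hj⟩ := hall
  replace hj : lam j < 0 := hj.lt_of_ne (h.ne_zero hns j)
  -- As the product is positive, one of the other two eigenvalues is positive and the other
  -- negative; `key` treats either labelling.
  have key : ∀ i k : Fin 3, i ≠ j → j ≠ k → i ≠ k → 0 < lam i → ∃ i j k : Fin 3,
      i ≠ j ∧ j ≠ k ∧ i ≠ k ∧
        ∃ η l : ℝ, 0 < η ∧ 0 < l ∧ lam i = η ∧ lam j = -l ∧ lam k = -l := by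
    intro i k hij hjk hik hi
    have hk : lam k < 0 := by
      have := h.mul_mul_pos hE hns hij hjk hik
      exact neg_of_mul_pos_right this (mul_neg_of_pos_of_neg hi hj).le
    refine ⟨i, j, k, hij, hjk, hik, lam i, -lam j, hi, by linarith, rfl, by simp, ?_⟩
    rw [neg_neg]
    exact le_antisymm (h.le_of_neg hE hij hjk hik hi hk) (h.le_of_neg hE hik hjk.symm hij hi hj)
  obtain ⟨i, k, hij, hjk, hik⟩ := exists_distinct j
  rcases (h.ne_zero hns i).lt_or_gt with hi | hi
  · refine key k i hjk.symm hij.symm hik.symm ?_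
    exact pos_of_mul_pos_right (h.mul_mul_pos hE hns hij hjk hik)
      (mul_pos_of_neg_of_neg hi hj).le
  · exact key i k hij hjk hik hi

/-! ### The principal logarithms -/

theorem exp_ofBlochMatrix_eq {E : Superoperator (Fin 2)} (hE : IsPauliChannel E)
    {lam : Fin 3 → ℝ} (hlam : HasPauliEigenvalues E lam) {A : Matrix (Fin 3) (Fin 3) ℝ}
    (h : ∀ a : Fin 3, NormedSpace.exp (ofBlochMatrix A) (pauliMatrix a.succ) =
      (lam a : ℂ) • pauliMatrix a.succ) : NormedSpace.exp (ofBlochMatrix A) = E :=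
  superoperator_ext_pauliMatrix (by rw [exp_ofBlochMatrix_one, hE.apply_one])
    fun a => by rw [h, hlam]

theorem exp_principalLogPos {E : Superoperator (Fin 2)} (hE : IsPauliChannel E)
    {lam : Fin 3 → ℝ} (hlam : HasPauliEigenvalues E lam) (hpos : ∀ i, 0 < lam i) :
    NormedSpace.exp (principalLogPos lam) = E := by
  refine exp_ofBlochMatrix_eq hE hlam fun a => ?_
  rw [Superoperator.exp_apply_eigenvector (c := (Real.log (lam a) : ℂ)), ← Complex.ofReal_exp,
    Real.exp_log (hpos a)]
  rw [ofBlochMatrix_pauliMatrix]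
  simp [Matrix.diagonal_apply, ite_smul]

/-- `X ± iY` are eigenvectors for `log l ± iπ`, and both eigenvalues exponentiate to `-l`. -/
theorem exp_apply_of_rotation {n : Type*} [Fintype n] [DecidableEq n] {L : Superoperator n}
    {X Y : Matrix n n ℂ} {l : ℝ} (hl : 0 < l)
    (hX : L X = (Real.log l : ℂ) • X - (Real.pi : ℂ) • Y)
    (hY : L Y = (Real.log l : ℂ) • Y + (Real.pi : ℂ) • X) :
    NormedSpace.exp L X = -(l : ℂ) • X ∧ NormedSpace.exp L Y = -(l : ℂ) • Y := by
  have hexp : Complex.exp (Real.log l) = l := by rw [← Complex.ofReal_exp, Real.exp_log hl]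
  have hI : (Complex.I * Complex.I) • Y = (-1 : ℂ) • Y := by rw [Complex.I_mul_I]
  have hp : NormedSpace.exp L (X + Complex.I • Y) = -(l : ℂ) • (X + Complex.I • Y) := by
    rw [Superoperator.exp_apply_eigenvector (c := Real.log l + Real.pi * Complex.I),
      Complex.exp_add, hexp, Complex.exp_pi_mul_I, mul_neg_one]
    rw [map_add, map_smul, hX, hY]
    linear_combination (norm := module) -(Real.pi : ℂ) • hI
  have hm : NormedSpace.exp L (X - Complex.I • Y) = -(l : ℂ) • (X - Complex.I • Y) := by
    rw [Superoperator.exp_apply_eigenvector (c := Real.log l - Real.pi * Complex.I),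
      Complex.exp_sub, hexp, Complex.exp_pi_mul_I, div_neg, div_one]
    rw [map_sub, map_smul, hX, hY]
    linear_combination (norm := module) -(Real.pi : ℂ) • hI
  rw [map_add, map_smul] at hp
  rw [map_sub, map_smul] at hm
  constructor
  · linear_combination (norm := module) (1 / 2 : ℂ) • hp + (1 / 2 : ℂ) • hm
  · have h2 : Complex.I • NormedSpace.exp L Y = Complex.I • (-(l : ℂ) • Y) := by
      linear_combination (norm := module) (1 / 2 : ℂ) • hp - (1 / 2 : ℂ) • hm
    exact smul_right_injective _ Complex.I_ne_zero h2

theorem exp_principalLogNeg {E : Superoperator (Fin 2)} (hE : IsPauliChannel E)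
    {lam : Fin 3 → ℝ} (hlam : HasPauliEigenvalues E lam) {i j k : Fin 3} (hij : i ≠ j)
    (hjk : j ≠ k) (hik : i ≠ k) {η l : ℝ} (hη : 0 < η) (hl : 0 < l) (hi : lam i = η)
    (hj : lam j = -l) (hk : lam k = -l) : NormedSpace.exp (principalLogNeg η l i j k) = E := by
  have h1 : principalLogNeg η l i j k (pauliMatrix i.succ) =
      (Real.log η : ℂ) • pauliMatrix i.succ := by
    rw [principalLogNeg, ofBlochMatrix_pauliMatrix]
    simp [Matrix.single_apply, hij.symm, hik.symm]
  have h2 : principalLogNeg η l i j k (pauliMatrix j.succ) =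
      (Real.log l : ℂ) • pauliMatrix j.succ - (Real.pi : ℂ) • pauliMatrix k.succ := by
    rw [principalLogNeg, ofBlochMatrix_pauliMatrix]
    simp [Matrix.single_apply, hij, hjk.symm, sub_smul]
  have h3 : principalLogNeg η l i j k (pauliMatrix k.succ) =
      (Real.log l : ℂ) • pauliMatrix k.succ + (Real.pi : ℂ) • pauliMatrix j.succ := by
    rw [principalLogNeg, ofBlochMatrix_pauliMatrix]
    simp [Matrix.single_apply, hik, hjk, add_smul, Finset.sum_add_distrib]
  have h23 := exp_apply_of_rotation hl h2 h3
  refine exp_ofBlochMatrix_eq hE hlam fun a => ?_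
  change NormedSpace.exp (principalLogNeg η l i j k) _ = _
  obtain rfl | rfl | rfl : a = i ∨ a = j ∨ a = k := by omega
  · rw [Superoperator.exp_apply_eigenvector h1, ← Complex.ofReal_exp,
      Real.exp_log hη, hi]
  · simpa [hj] using h23.1
  · simpa [hk] using h23.2

/-- `Real.log` is `log |·|`, so one statement serves both sign patterns. -/
theorem log_add_log_le {a b c : ℝ} (ha : a ≠ 0) (hb : b ≠ 0) (hc : c ≠ 0)
    (h : a / (b * c) ≥ 1) : Real.log b + Real.log c ≤ Real.log a := by
  have := Real.log_nonneg h
  rw [Real.log_div ha (mul_ne_zero hb hc), Real.log_mul hb hc] at this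
  linarith

theorem hasLindbladForm_principalLogPos {lam : Fin 3 → ℝ} (h0 : ∀ i, lam i ≠ 0)
    (h : ∀ i j k : Fin 3, i ≠ j → j ≠ k → i ≠ k → lam i / (lam j * lam k) ≥ 1) :
    HasLindbladForm (principalLogPos lam) := by
  have hlog := fun i j k hij hjk hik => log_add_log_le (h0 i) (h0 j) (h0 k) (h i j k hij hjk hik)
  rw [principalLogPos]
  convert hasLindbladForm_ofBlochMatrix (fun i => Real.log (lam i)) 0
    (hlog 0 1 2 (by decide) (by decide) (by decide))
    (hlog 1 0 2 (by decide) (by decide) (by decide))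
    (hlog 2 0 1 (by decide) (by decide) (by decide)) using 2
  ext a b
  fin_cases a <;> fin_cases b <;> simp

theorem hasLindbladForm_principalLogNeg {lam : Fin 3 → ℝ} (h0 : ∀ i, lam i ≠ 0)
    (h : ∀ i j k : Fin 3, i ≠ j → j ≠ k → i ≠ k → lam i / (lam j * lam k) ≥ 1) {i j k : Fin 3}
    (hij : i ≠ j) (hjk : j ≠ k) (hik : i ≠ k) {η l : ℝ} (hi : lam i = η)
    (hj : lam j = -l) (hk : lam k = -l) : HasLindbladForm (principalLogNeg η l i j k) := by
  have hlog := fun i j k hij hjk hik => log_add_log_le (h0 i) (h0 j) (h0 k) (h i j k hij hjk hik)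
  replace hi : Real.log (lam i) = Real.log η := by rw [hi]
  replace hj : Real.log (lam j) = Real.log l := by rw [hj, Real.log_neg_eq_log]
  replace hk : Real.log (lam k) = Real.log l := by rw [hk, Real.log_neg_eq_log]
  rw [principalLogNeg]
  convert hasLindbladForm_ofBlochMatrix (fun i => Real.log (lam i))
    -- A half turn about axis `i`; the sign is the orientation of `(i, k, j)`, with `i + 1` taken
    -- modulo 3.
    (fun a => if a = i then if k = i + 1 then Real.pi else -Real.pi else 0)
    (hlog 0 1 2 (by decide) (by decide) (by decide))
    (hlog 1 0 2 (by decide) (by decide) (by decide))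
    (hlog 2 0 1 (by decide) (by decide) (by decide)) using 2
  obtain ⟨rfl, rfl, rfl⟩ | ⟨rfl, rfl, rfl⟩ | ⟨rfl, rfl, rfl⟩ | ⟨rfl, rfl, rfl⟩ | ⟨rfl, rfl, rfl⟩ |
    ⟨rfl, rfl, rfl⟩ := distinct_cases hij hjk hik
  all_goals
    ext a b
    fin_cases a <;> fin_cases b <;> simp [hi, hj, hk]

theorem IsPauliChannel.mem_lDivisibleChannels {E L : Superoperator (Fin 2)}
    (hE : IsPauliChannel E) (hns : IsUnit E) (hexp : NormedSpace.exp L = E)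
    (hL : HasLindbladForm L) : E ∈ lDivisibleChannels (Fin 2) :=
  subset_closure ⟨hE.isQuantumChannel, hns, L, hexp, hL⟩

theorem mainTheorem1 (E : Superoperator (Fin 2)) (hE : IsPauliChannel E) (hns : IsUnit E)
    (lam : Fin 3 → ℝ) (hlam : HasPauliEigenvalues E lam) :
    (E ∈ lDivisibleChannels (Fin 2) ↔
      ((∀ i, 0 < lam i) ∨
        ∃ i j k : Fin 3, i ≠ j ∧ j ≠ k ∧ i ≠ k ∧
          ∃ η l : ℝ, 0 < η ∧ 0 < l ∧ lam i = η ∧ lam j = -l ∧ lam k = -l) ∧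
      ∀ i j k : Fin 3, i ≠ j → j ≠ k → i ≠ k → lam i / (lam j * lam k) ≥ 1) ∧
    ((∀ i, 0 < lam i) →
      NormedSpace.exp (principalLogPos lam) = E ∧
      (E ∈ lDivisibleChannels (Fin 2) ↔ HasLindbladForm (principalLogPos lam))) ∧
    (∀ i j k : Fin 3, i ≠ j → j ≠ k → i ≠ k →
      ∀ η l : ℝ, 0 < η → 0 < l → lam i = η → lam j = -l → lam k = -l →
        NormedSpace.exp (principalLogNeg η l i j k) = E ∧
        (E ∈ lDivisibleChannels (Fin 2) ↔ HasLindbladForm (principalLogNeg η l i j k))) := by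
  have h0 := hlam.ne_zero hns
  have hdiv : E ∈ lDivisibleChannels (Fin 2) →
      ∀ i j k : Fin 3, i ≠ j → j ≠ k → i ≠ k → lam i / (lam j * lam k) ≥ 1 :=
    fun h _ _ _ hij hjk hik => hlam.one_le_div h hns hij hjk hik
  refine ⟨⟨fun h => ⟨hlam.sign_pattern h hns, hdiv h⟩, ?_⟩, fun hpos => ?_, ?_⟩
  · rintro ⟨hpos | ⟨i, j, k, hij, hjk, hik, η, l, hη, hl, hi, hj, hk⟩, h⟩
    · exact hE.mem_lDivisibleChannels hns (exp_principalLogPos hE hlam hpos)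
        (hasLindbladForm_principalLogPos h0 h)
    · exact hE.mem_lDivisibleChannels hns
        (exp_principalLogNeg hE hlam hij hjk hik hη hl hi hj hk)
        (hasLindbladForm_principalLogNeg h0 h hij hjk hik hi hj hk)
  · have hexp := exp_principalLogPos hE hlam hpos
    -- Membership gives condition 2 by closedness, and condition 2 alone makes the principal
    -- logarithm Lindblad; no other branch has to be examined.
    exact ⟨hexp, fun h => hasLindbladForm_principalLogPos h0 (hdiv h),
      hE.mem_lDivisibleChannels hns hexp⟩
  · intro i j k hij hjk hik η l hη hl hi hj hk
    have hexp := exp_principalLogNeg hE hlam hij hjk hik hη hl hi hj hk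
    exact ⟨hexp, fun h => hasLindbladForm_principalLogNeg h0 (hdiv h) hij hjk hik hi hj hk,
      hE.mem_lDivisibleChannels hns hexp⟩
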